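/- Work with localic (point-free) spaces: a space is given by a propositional geometric theory, its opens are the geometric formulae modulo provable equivalence, and a subspace is given by adding axioms. An absolute value on $\mathbb{Q}$ assigns to each $x\in\mathbb{Q}$ a Dedekind real $|x|\in[0,\infty)$ with $|0|=0$, $|1|=1$, $|xy|=|x||y|$, $|x+y|\le|x|+|y|$, and $|x|>0$ for $x\neq 0$; let $[\mathrm{av}]$ be the space of these. Let $[\mathrm{av}_A]$ be the subspace of Archimedean absolute values, those with $1\le|n|$ for all nonzero integers $n$ (so the trivial absolute value, $|x|=1$ for $x\ne0$, is included), and let $[\mathrm{av}_{A^+}]$ be the open subspace of non-trivial Archimedean ones, those with $|n|>1$ for some nonzero integer $n$. For a real $\alpha$ let $|\cdot|_\infty^\alpha$ be the map sending $0$ to $0$ and $x\neq0$ to $|x|_\infty^\alpha$, where $|\cdot|_\infty$ is the usual absolute value. **Proposition 5.7.** There are isomorphisms of point-free spaces $$[\mathrm{av}_A]\cong[0,1],\qquad [\mathrm{av}_{A^+}]\cong(0,1],$$ where $[0,1]$ and $(0,1]$ are the spaces of Dedekind reals in these intervals. Both are given by $|\cdot|\mapsto\log_2|2|$, with inverse $\alpha\mapsto|\cdot|_\infty^\alpha$.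 In particular, for every (generalised) point $|\cdot|$ of $[\mathrm{av}_A]$ there is $\alpha\in[0,1]$, namely $\alpha=\log_2|2|$, such that $|\cdot|=|\cdot|_\infty^\alpha$, and $\alpha>0$ if $|\cdot|$ is non-trivial. This applies in particular to every ordinary real-valued absolute value on $\mathbb{Q}$ with $1\le|n|$ for all nonzero integers $n$. -/

import Mathlib

open CategoryTheory

noncomputable section

namespace PointFree

/-! ### Propositional geometric theories, their models, and the spaces they describe -/

/-- A geometric sequent `⋀ ant → ⋁_{D ∈ suc} ⋀ D` over the propositional symbols `G`: finite
conjunctions, arbitrary disjunctions. Every propositional geometric sequent is equivalent to a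
set of sequents of this form. -/
structure Sequent (G : Type) where
  ant : Finset G
  suc : Set (Finset G)

/-- A propositional geometric theory with symbols `G`. A larger set of axioms over the same symbols
describes a subspace. -/
abbrev Theory (G : Type) := Set (Sequent G)

/-- The meaning of a finite conjunction of symbols under a valuation in a frame. -/
def conj {G : Type} {L : Type*} [Order.Frame L] (v : G → L) (A : Finset G) : L := ⨅ g ∈ A, v g

/-- `v` is a model of the theory `T` in the frame `L`, i.e. a (generalised) point of the space of
models of `T` at stage `L`. -/
def IsModel {G : Type} {L : Type*} [Order.Frame L] (T : Theory G) (v : G → L) : Prop :=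
  ∀ s ∈ T, conj v s.ant ≤ ⨆ D ∈ s.suc, conj v D

/-- The opens of the space of models of `T`: geometric formulae modulo provable equivalence.
A formula `⋁_i ⋀ A_i` is represented by the set of all finite conjunctions that entail it,
that is, by a set of finite conjunctions closed under strengthening and under the axioms of `T`. -/
@[ext]
structure Opens {G : Type} (T : Theory G) where
  carrier : Set (Finset G)
  mono : ∀ A ∈ carrier, ∀ B, A ⊆ B → B ∈ carrier
  closed : ∀ s ∈ T, ∀ A, s.ant ⊆ A →
    (∀ D ∈ s.suc, ∀ B, A ⊆ B → D ⊆ B → B ∈ carrier) → A ∈ carrier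

namespace Opens

variable {G : Type} {T : Theory G}

instance : PartialOrder (Opens T) where
  le S S' := S.carrier ⊆ S'.carrier
  le_refl _ := subset_rfl
  le_trans _ _ _ h h' := subset_trans h h'
  le_antisymm _ _ h h' := Opens.ext (subset_antisymm h h')

instance : InfSet (Opens T) where
  sInf F :=
    { carrier := {A | ∀ S ∈ F, A ∈ S.carrier}
      mono := fun _ hA _ hAB S hS => S.mono _ (hA S hS) _ hAB
      closed := fun s hs A hsA h S hS =>
        S.closed s hs A hsA fun D hD B hAB hDB => h D hD B hAB hDB S hS }

theorem isGLB_sInf (F : Set (Opens T)) : IsGLB F (sInf F) :=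
  ⟨fun S hS _ hA => hA S hS, fun _ hS _ hA _ hS' => hS hS' hA⟩

instance : CompleteLattice (Opens T) := completeLatticeOfInf (Opens T) isGLB_sInf

/-- Heyting implication of opens. -/
def imp (S S' : Opens T) : Opens T where
  carrier := {A | ∀ B, A ⊆ B → B ∈ S.carrier → B ∈ S'.carrier}
  mono _ hA _ hAB C hBC hC := hA C (hAB.trans hBC) hC
  closed s hs _ hsA h B hAB hB :=
    S'.closed s hs B (hsA.trans hAB) fun D hD C hBC hDC =>
      h D hD C (hAB.trans hBC) hDC C subset_rfl (S.mono B hB C hBC)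

theorem mem_inf {S S' : Opens T} {A : Finset G} :
    A ∈ (S ⊓ S').carrier ↔ A ∈ S.carrier ∧ A ∈ S'.carrier := by
  constructor
  · exact fun h => ⟨(inf_le_left : S ⊓ S' ≤ S) h, (inf_le_right : S ⊓ S' ≤ S') h⟩
  · rintro ⟨h, h'⟩
    have key : sInf {S, S'} ≤ S ⊓ S' :=
      le_inf (sInf_le (Set.mem_insert _ _)) (sInf_le (Set.mem_insert_of_mem _ rfl))
    refine key ?_
    rintro U (rfl | rfl)
    exacts [h, h']

theorem le_imp_iff (S U V : Opens T) : S ≤ imp U V ↔ S ⊓ U ≤ V := by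
  constructor
  · intro h A hA
    exact h (mem_inf.1 hA).1 A subset_rfl (mem_inf.1 hA).2
  · intro h A hA B hAB hB
    exact h (mem_inf.2 ⟨S.mono A hA B hAB, hB⟩)

instance : Order.Frame (Opens T) :=
  Order.Frame.ofMinimalAxioms
    { inf_sSup_le_iSup_inf := fun S F => by
        have h : sSup F ≤ imp S (⨆ U ∈ F, S ⊓ U) := sSup_le fun U hU => by
          rw [le_imp_iff, inf_comm]
          exact le_iSup₂ (f := fun U (_ : U ∈ F) => S ⊓ U) U hU
        rw [inf_comm]
        exact (le_imp_iff _ _ _).1 h }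

end Opens

/-- The open given by a propositional symbol `g`: the least open containing the conjunction `g`. -/
def gen {G : Type} (T : Theory G) (g : G) : Opens T := sInf {S | {g} ∈ S.carrier}

/-- The point-free space of models of `T`. -/
def space {G : Type} (T : Theory G) : Locale.{0} := Locale.of (Opens T)

/-- The inverse image of opens along a map of locales. -/
def inverseImage {X Y : Locale.{0}} (f : X ⟶ Y) : FrameHom Y X :=
  Frm.Hom.hom (Quiver.Hom.unop (V := Frm.{0}) f)

/-- For a map into the space of models of `T`, the model of `T` in the opens of its domain
(the image of the generic point of the domain). -/
def pull {G G' : Type} {T : Theory G} {T' : Theory G'} (f : space T ⟶ space T') (g : G') :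
    Opens T :=
  inverseImage f (gen T' g)

/-! ### Dedekind reals -/

open Classical in
/-- The axioms that make `x` a Dedekind real, where `lo q` stands for `q < x` and `up q` for
`x < q`: inhabited rounded sections that are disjoint and located. -/
inductive DedekindAx {G : Type} (lo up : ℚ → G) : Sequent G → Prop
  | lo_inhabited : DedekindAx lo up ⟨∅, {D | ∃ q, D = {lo q}}⟩
  | up_inhabited : DedekindAx lo up ⟨∅, {D | ∃ q, D = {up q}}⟩
  | lo_down (q q' : ℚ) (h : q < q') : DedekindAx lo up ⟨{lo q'}, {{lo q}}⟩
  | up_up (q q' : ℚ) (h : q < q') : DedekindAx lo up ⟨{up q}, {{up q'}}⟩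
  | lo_rounded (q : ℚ) : DedekindAx lo up ⟨{lo q}, {D | ∃ q', q < q' ∧ D = {lo q'}}⟩
  | up_rounded (q : ℚ) : DedekindAx lo up ⟨{up q}, {D | ∃ q', q' < q ∧ D = {up q'}}⟩
  | disjoint (q : ℚ) : DedekindAx lo up ⟨{lo q, up q}, ∅⟩
  | located (q r : ℚ) (h : q < r) : DedekindAx lo up ⟨∅, {{lo q}, {up r}}⟩

/-- Symbols for a real `t`. -/
inductive RealSym
  /-- `q < t` -/
  | gt (q : ℚ)
  /-- `t < q` -/
  | lt (q : ℚ)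

/-- The theory of Dedekind reals `t`. -/
def realTheory : Theory RealSym := {s | DedekindAx RealSym.gt RealSym.lt s}

/-- The theory of the closed interval `[0,1]`: `t < 0` and `1 < t` are impossible. -/
def Icc01 : Theory RealSym := realTheory ∪ {⟨{.lt 0}, ∅⟩, ⟨{.gt 1}, ∅⟩}

/-- The theory of the half-open interval `(0,1]`: `0 < t` holds and `1 < t` is impossible. -/
def Ioc01 : Theory RealSym := realTheory ∪ {⟨∅, {{.gt 0}}⟩, ⟨{.gt 1}, ∅⟩}

/-! ### Absolute values on the rationals -/

/-- Symbols for an absolute value on `ℚ`. -/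
inductive AbsSym
  /-- `q < |x|` -/
  | gt (q x : ℚ)
  /-- `|x| < q` -/
  | lt (x q : ℚ)

open Classical in
/-- The axioms of positive definite Dedekind absolute values on `ℚ`. Equations and inequalities
between nonnegative reals are expressed through their upper sections. -/
inductive AbsAx : Sequent AbsSym → Prop
  /-- each `|x|` is a Dedekind real -/
  | dedekind (x : ℚ) (s : Sequent AbsSym) (h : DedekindAx (fun q => .gt q x) (fun q => .lt x q) s) :
      AbsAx s
  /-- `0 ≤ |x|` -/
  | nonneg (x : ℚ) : AbsAx ⟨{.lt x 0}, ∅⟩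
  /-- `|0| ≤ 0` -/
  | zero (q : ℚ) (h : 0 < q) : AbsAx ⟨∅, {{.lt 0 q}}⟩
  /-- `|1| ≤ 1` -/
  | one_le (q : ℚ) (h : 1 < q) : AbsAx ⟨∅, {{.lt 1 q}}⟩
  /-- `1 ≤ |1|` -/
  | le_one : AbsAx ⟨{.lt 1 1}, ∅⟩
  /-- `|x y| ≤ |x| |y|` -/
  | mul_le (x y r s : ℚ) (hr : 0 < r) (hs : 0 < s) :
      AbsAx ⟨{.lt x r, .lt y s}, {{.lt (x * y) (r * s)}}⟩
  /-- `|x| |y| ≤ |x y|` -/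
  | le_mul (x y q : ℚ) :
      AbsAx ⟨{.lt (x * y) q},
        {D | ∃ r s : ℚ, 0 < r ∧ 0 < s ∧ r * s ≤ q ∧ D = {.lt x r, .lt y s}}⟩
  /-- `|x + y| ≤ |x| + |y|` -/
  | triangle (x y r s : ℚ) : AbsAx ⟨{.lt x r, .lt y s}, {{.lt (x + y) (r + s)}}⟩
  /-- `x = 0 ∨ 0 < |x|` -/
  | posDef (x : ℚ) : AbsAx ⟨∅, {D | (x = 0 ∧ D = ∅) ∨ D = {.gt 0 x}}⟩

/-- The theory of absolute values on `ℚ` (Dedekind valued and positive definite). -/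
def absTheory : Theory AbsSym := {s | AbsAx s}

/-- Archimedean absolute values (the trivial one included): `|n| < 1` is impossible for every
nonzero integer `n`. This is the closed complement of `∃ n ≠ 0, |n| < 1`. -/
def archTheory : Theory AbsSym :=
  absTheory ∪ {s | ∃ n : ℤ, n ≠ 0 ∧ s = ⟨{.lt n 1}, ∅⟩}

/-- Nontrivial Archimedean absolute values: `1 < |n|` for some nonzero integer `n`. -/
def archPosTheory : Theory AbsSym :=
  absTheory ∪ {⟨∅, {D | ∃ n : ℤ, n ≠ 0 ∧ D = {.gt 1 n}}⟩}

/-- `t = log₂ |2|`, for a real `t` and an absolute value `N` at stage `L`: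
`t < q` iff `|2| < 2 ^ q`, and `q < t` iff `2 ^ q < |2|`. -/
def IsLogTwo {L : Type*} [Order.Frame L] (t : RealSym → L) (N : AbsSym → L) : Prop :=
  ∀ q : ℚ,
    t (.lt q) = (⨆ (s : ℚ) (_ : (s : ℝ) < (2 : ℝ) ^ (q : ℝ)), N (.lt 2 s)) ∧
    t (.gt q) = (⨆ (s : ℚ) (_ : (2 : ℝ) ^ (q : ℝ) < (s : ℝ)), N (.gt s 2))

/-- `N` is the `t`-th power of the usual absolute value, for an absolute value `N` and a real `t`
at stage `L`. For `x ≠ 0` and `y = |x|_∞`, the condition `y ^ t < q` holds iff there are rationals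
`a < t < b` with `y ^ a < q` and `y ^ b < q` (as `y ^ (-)` is monotone or antitone and
continuous), and dually for `q < y ^ t`. The power of `0` is `0`, also for `t = 0`. -/
def IsAbsPow {L : Type*} [Order.Frame L] (N : AbsSym → L) (t : RealSym → L) : Prop :=
  (∀ x : ℚ, x ≠ 0 → ∀ q : ℚ,
    N (.lt x q) = (⨆ (a : ℚ) (b : ℚ)
      (_ : ((|x| : ℚ) : ℝ) ^ (a : ℝ) < (q : ℝ) ∧ ((|x| : ℚ) : ℝ) ^ (b : ℝ) < (q : ℝ)),
        t (.gt a) ⊓ t (.lt b)) ∧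
    N (.gt q x) = (⨆ (a : ℚ) (b : ℚ)
      (_ : (q : ℝ) < ((|x| : ℚ) : ℝ) ^ (a : ℝ) ∧ (q : ℝ) < ((|x| : ℚ) : ℝ) ^ (b : ℝ)),
        t (.gt a) ⊓ t (.lt b))) ∧
  ∀ q : ℚ, N (.lt 0 q) = (⨆ _ : 0 < q, ⊤) ∧ N (.gt q 0) = (⨆ _ : q < 0, ⊤)

end PointFree

end

noncomputable section

namespace PointFree

/-! ### Opens classify models -/

section Classifying

open Classical

variable {G G' : Type} {T : Theory G} {T' : Theory G'}

/-! The point-free statement reduces to a statement about real numbers because all the theories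
involved have countably many axioms. For such a theory, an inequality between opens holds once it
holds at every model in `Prop` (`le_of_points`), by a Henkin-style chain of finite conjunctions
(`exists_point_of_notMem`). So equality of opens, and being a model in the opens of such a space,
can be tested at points (`eq_of_points`, `isModel_of_points`).

At the points classical mathematics applies. A cut in `Prop` is a real number, and a model of the
absolute value axioms is an `AbsoluteValue ℚ ℝ`. By Ostrowski's theorem an absolute value that
exceeds `1` at some integer is a power of the usual one; the triangle inequality at `1 + 1` bounds
the exponent by `1`. If instead every nonzero integer has value `1`, the absolute value is trivial
and the exponent is `0`.

The maps `logTwo` and `powOf` are geometric formulae, hence commute with frame homomorphisms.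
Applied to generic models they are mutually inverse, since they are so at every point. A model in an
arbitrary frame is the image of the generic one, so the conclusions transfer to it, even when that
frame has no points. -/

theorem conj_anti {L : Type*} [Order.Frame L] (v : G → L) {A B : Finset G} (h : A ⊆ B) :
    conj v B ≤ conj v A :=
  le_iInf₂ fun g hg => iInf₂_le g (h hg)

theorem conj_union {L : Type*} [Order.Frame L] (v : G → L) (A B : Finset G) :
    conj v (A ∪ B) = conj v A ⊓ conj v B :=
  Finset.iInf_union

theorem conj_empty {L : Type*} [Order.Frame L] (v : G → L) : conj v ∅ = ⊤ := by
  simp [conj]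

theorem conj_singleton {L : Type*} [Order.Frame L] (v : G → L) (g : G) : conj v {g} = v g := by
  simp [conj]

theorem map_conj {L M : Type*} [Order.Frame L] [Order.Frame M] (F : FrameHom L M) (v : G → L)
    (A : Finset G) : F (conj v A) = conj (fun g => F (v g)) A := by
  induction A using Finset.induction_on with
  | empty => simp [conj_empty]
  | insert g A _ ih => rw [Finset.insert_eq, conj_union, conj_union, map_inf, ih]; simp [conj_singleton]

theorem conj_prop (v : G → Prop) (A : Finset G) : conj v A ↔ ∀ g ∈ A, v g := by
  simp [conj]

theorem IsModel.map {L M : Type*} [Order.Frame L] [Order.Frame M] (F : FrameHom L M) {v : G → L}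
    (hv : IsModel T v) : IsModel T (fun g => F (v g)) := by
  intro s hs
  have := OrderHomClass.mono F (hv s hs)
  simpa only [map_iSup, map_conj] using this

/-- The open given by a finite conjunction of symbols. -/
def basicOpen (T : Theory G) (A : Finset G) : Opens T := sInf {S | A ∈ S.carrier}

theorem basicOpen_le {A : Finset G} {U : Opens T} : basicOpen T A ≤ U ↔ A ∈ U.carrier :=
  ⟨fun h => h fun _ hS => hS, fun h => sInf_le h⟩

theorem mem_basicOpen (A : Finset G) : A ∈ (basicOpen T A).carrier := basicOpen_le.1 le_rfl

theorem basicOpen_anti {A B : Finset G} (h : A ⊆ B) : basicOpen T B ≤ basicOpen T A :=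
  basicOpen_le.2 ((basicOpen T A).mono A (mem_basicOpen A) B h)

/-- The sets `B` such that `B ∪ C` belongs to `U`. -/
def Opens.shift (U : Opens T) (C : Finset G) : Opens T where
  carrier := {B | B ∪ C ∈ U.carrier}
  mono _ hA _ hAB := U.mono _ hA _ (Finset.union_subset_union_left hAB)
  closed s hs A hsA h := U.closed s hs _ (hsA.trans Finset.subset_union_left) fun D hD E hE hDE => by
    have hE' := Finset.union_subset_iff.1 hE
    have := h D hD E hE'.1 hDE
    rwa [Set.mem_ofPred_eq, Finset.union_eq_left.2 hE'.2] at this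

theorem basicOpen_union (A B : Finset G) :
    basicOpen T (A ∪ B) = basicOpen T A ⊓ basicOpen T B := by
  apply le_antisymm
  · exact le_inf (basicOpen_anti Finset.subset_union_left) (basicOpen_anti Finset.subset_union_right)
  · rw [← Opens.le_imp_iff, basicOpen_le]
    intro C hAC hC
    -- As `A ⊆ C`, the shifted open contains `B`, hence all of `basicOpen T B`. In particular it
    -- contains `C`, and `C ∪ C = C`.
    have h : basicOpen T B ≤ (basicOpen T (A ∪ B)).shift C :=
      basicOpen_le.2 ((basicOpen T (A ∪ B)).mono _ (mem_basicOpen _) _ (Finset.union_subset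
        (hAC.trans Finset.subset_union_right) Finset.subset_union_left))
    have := h hC
    simpa [Opens.shift] using this

theorem basicOpen_empty : basicOpen T ∅ = ⊤ :=
  top_unique fun A _ => (basicOpen T ∅).mono ∅ (mem_basicOpen _) A (Finset.empty_subset _)

theorem conj_gen (A : Finset G) : conj (gen T) A = basicOpen T A := by
  induction A using Finset.induction_on with
  | empty => rw [conj_empty, basicOpen_empty]
  | insert g A _ ih =>
    rw [Finset.insert_eq, conj_union, basicOpen_union, ih, conj_singleton]; rfl

theorem Opens.eq_iSup (U : Opens T) : U = ⨆ A ∈ U.carrier, conj (gen T) A := by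
  apply le_antisymm
  · intro A hA
    refine (le_iSup₂ (f := fun A (_ : A ∈ U.carrier) => conj (gen T) A) A hA) ?_
    rw [conj_gen]
    exact mem_basicOpen A
  · exact iSup₂_le fun A hA => by rw [conj_gen]; exact basicOpen_le.2 hA

variable {L : Type*} [Order.Frame L]

/-- The value of an open at a model. -/
def eval (v : G → L) (U : Opens T) : L := ⨆ A ∈ U.carrier, conj v A

/-- The largest open whose value at a model is at most `b`. -/
def evalAdj {v : G → L} (hv : IsModel T v) (b : L) : Opens T where
  carrier := {A | conj v A ≤ b}
  mono _ hA _ hAB := (conj_anti v hAB).trans hA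
  closed s hs A hsA h := by
    have h1 : conj v A ≤ ⨆ D ∈ s.suc, conj v D := (conj_anti v hsA).trans (hv s hs)
    have h2 : conj v A ≤ conj v A ⊓ ⨆ D ∈ s.suc, conj v D := le_inf le_rfl h1
    refine h2.trans ?_
    rw [inf_iSup₂_eq]
    refine iSup₂_le fun D hD => ?_
    rw [← conj_union]
    exact h D hD _ Finset.subset_union_left Finset.subset_union_right

/-- As a left adjoint, `eval v` preserves all joins; this is the part of `lift` that uses the axioms
of `T`. -/
theorem gc_eval {v : G → L} (hv : IsModel T v) :
    GaloisConnection (eval v : Opens T → L) (evalAdj hv) := by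
  intro U b
  exact ⟨fun h A hA => (le_iSup₂ (f := fun A (_ : A ∈ U.carrier) => conj v A) A hA).trans h,
    fun h => iSup₂_le fun A hA => h hA⟩

/-- The frame homomorphism classifying a model. -/
def lift {v : G → L} (hv : IsModel T v) : FrameHom (Opens T) L where
  toFun := eval v
  map_inf' U V := by
    apply le_antisymm
    · exact le_inf ((gc_eval hv).monotone_l inf_le_left) ((gc_eval hv).monotone_l inf_le_right)
    · simp only [eval, iSup₂_inf_eq, inf_iSup₂_eq, ← conj_union]
      refine iSup₂_le fun B hB => iSup₂_le fun A hA => ?_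
      refine le_iSup₂ (f := fun A (_ : A ∈ (U ⊓ V).carrier) => conj v A) (A ∪ B) ?_
      exact Opens.mem_inf.2 ⟨U.mono _ hA _ Finset.subset_union_left,
        V.mono _ hB _ Finset.subset_union_right⟩
  map_top' := by
    refine top_unique ?_
    rw [← conj_empty v]
    refine le_iSup₂ (f := fun A (_ : A ∈ (⊤ : Opens T).carrier) => conj v A) ∅ ?_
    exact (basicOpen_empty (T := T)).le (mem_basicOpen ∅)
  map_sSup' F := by
    rw [(gc_eval hv).l_sSup, sSup_image]

theorem lift_gen {v : G → L} (hv : IsModel T v) (g : G) : lift hv (gen T g) = v g := by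
  apply le_antisymm
  · refine (gc_eval hv).l_le (basicOpen_le.2 ?_)
    exact (conj_singleton v g).le
  · rw [← conj_singleton v g]
    exact le_iSup₂ (f := fun A (_ : A ∈ (gen T g).carrier) => conj v A) {g} (mem_basicOpen {g})

/-- Every open is a join of finite meets of generators, and frame homomorphisms preserve both. -/
theorem frameHom_ext {F F' : FrameHom (Opens T) L} (h : ∀ g, F (gen T g) = F' (gen T g)) :
    F = F' := by
  ext U
  rw [U.eq_iSup]
  simp only [map_iSup, map_conj, h]

/-! ### Enough points -/

/-- Starting from `A`, an increasing sequence of finite sets outside `V` is built that satisfies the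
axioms one at a time. If `B ∉ V` contains the antecedent of an axiom, closedness of `V` yields a
disjunct that can be added while staying outside `V`. The union of the sequence is the point. -/
theorem exists_point_of_notMem (hT : T.Countable) {V : Opens T} {A : Finset G}
    (hA : A ∉ V.carrier) :
    ∃ p : G → Prop, IsModel T p ∧ (∀ g ∈ A, p g) ∧ ∀ B ∈ V.carrier, ¬ ∀ g ∈ B, p g := by
  have key : ∀ (s : Sequent G) (B : {B : Finset G // B ∉ V.carrier}),
      ∃ C : {B : Finset G // B ∉ V.carrier}, B.1 ⊆ C.1 ∧
        (s ∈ T → s.ant ⊆ B.1 → ∃ D ∈ s.suc, D ⊆ C.1) := by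
    rintro s ⟨B, hB⟩
    by_cases h : s ∈ T ∧ s.ant ⊆ B
    · have := mt (V.closed s h.1 B h.2) hB
      push Not at this
      obtain ⟨D, hD, C, hBC, hDC, hC⟩ := this
      exact ⟨⟨C, hC⟩, hBC, fun _ _ => ⟨D, hD, hDC⟩⟩
    · exact ⟨⟨B, hB⟩, subset_rfl, fun h1 h2 => (h ⟨h1, h2⟩).elim⟩
  choose next next_le next_spec using key
  obtain ⟨e, he⟩ : ∃ e : ℕ → Sequent G, T ⊆ Set.range e := by
    rcases T.eq_empty_or_nonempty with rfl | hne
    · exact ⟨fun _ => ⟨∅, ∅⟩, Set.empty_subset _⟩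
    · obtain ⟨e, he⟩ := hT.exists_eq_range hne
      exact ⟨e, he.le⟩
  -- Stage `n` treats the axiom numbered by the first component of `n.unpair`, so every axiom is
  -- treated at arbitrarily late stages.
  let c : ℕ → {B : Finset G // B ∉ V.carrier} := fun n =>
    Nat.rec ⟨A, hA⟩ (fun n B => next (e n.unpair.1) B) n
  have hc : ∀ n, c (n + 1) = next (e n.unpair.1) (c n) := fun n => rfl
  have hmono : Monotone fun n => (c n).1 := monotone_nat_of_le_succ fun n => by
    simp only [hc]; exact next_le _ _
  have hfin : ∀ B : Finset G, (∀ g ∈ B, ∃ n, g ∈ (c n).1) → ∃ n, B ⊆ (c n).1 := by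
    intro B hB
    choose! m hm using hB
    exact ⟨B.sup m, fun g hg => hmono (Finset.le_sup hg) (hm g hg)⟩
  refine ⟨fun g => ∃ n, g ∈ (c n).1, ?_, fun g hg => ⟨0, hg⟩, fun B hB h => ?_⟩
  · intro s hs hant
    rw [conj_prop] at hant
    obtain ⟨n, hn⟩ := hfin _ hant
    obtain ⟨k, rfl⟩ := he hs
    -- The antecedent is present from stage `n` on, and stage `Nat.pair k n` treats axiom `k` no
    -- earlier than that.
    have hle : n ≤ Nat.pair k n := Nat.right_le_pair k n
    obtain ⟨D, hD, hDC⟩ := next_spec (e k) (c (Nat.pair k n)) hs (hn.trans (hmono hle))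
    simp only [iSup_Prop_eq, conj_prop]
    refine ⟨D, hD, fun g hg => ⟨Nat.pair k n + 1, ?_⟩⟩
    rw [hc, Nat.unpair_pair]
    exact hDC hg
  · obtain ⟨n, hn⟩ := hfin B h
    exact (c n).2 (V.mono _ hB _ hn)

/-- A point-free space described by countably many axioms has enough points. -/
theorem le_of_points (hT : T.Countable) {U V : Opens T}
    (h : ∀ (p : G → Prop) (hp : IsModel T p), lift hp U → lift hp V) : U ≤ V := by
  intro A hA
  by_contra hAV
  obtain ⟨p, hp, hpA, hpV⟩ := exists_point_of_notMem hT hAV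
  have h1 : lift hp U := by
    change ⨆ A ∈ U.carrier, conj p A
    simp only [iSup_Prop_eq, conj_prop]
    exact ⟨A, hA, hpA⟩
  have h2 : ⨆ A ∈ V.carrier, conj p A := h p hp h1
  simp only [iSup_Prop_eq, conj_prop] at h2
  obtain ⟨B, hB, hB'⟩ := h2
  exact hpV B hB hB'

theorem eq_of_points (hT : T.Countable) {U V : Opens T}
    (h : ∀ (p : G → Prop) (hp : IsModel T p), lift hp U ↔ lift hp V) : U = V :=
  le_antisymm (le_of_points hT fun p hp => (h p hp).1) (le_of_points hT fun p hp => (h p hp).2)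

/-- Validity of a sequent is an inequality between opens of `T`, so only the axioms of `T` need to
be countable. -/
theorem isModel_of_points (hT : T.Countable) {w : G' → Opens T}
    (h : ∀ (p : G → Prop) (hp : IsModel T p), IsModel T' fun g => lift hp (w g)) :
    IsModel T' w := by
  intro s hs
  refine le_of_points hT fun p hp => ?_
  simp only [map_iSup, map_conj]
  exact h p hp s hs

/-- Mutually inverse models in each other's opens give an isomorphism of spaces. -/
theorem exists_iso {w : G' → Opens T} {w' : G → Opens T'} (hw : IsModel T' w) (hw' : IsModel T w')
    (h : ∀ g, lift hw (w' g) = gen T g) (h' : ∀ g, lift hw' (w g) = gen T' g) :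
    ∃ e : space T ≅ space T', pull e.hom = w ∧ pull e.inv = w' := by
  have H : (lift hw).comp (lift hw') = FrameHom.id _ :=
    frameHom_ext fun g => by simp [lift_gen, h]
  have H' : (lift hw').comp (lift hw) = FrameHom.id _ :=
    frameHom_ext fun g => by simp [lift_gen, h']
  refine ⟨⟨(Frm.ofHom (lift hw)).op, (Frm.ofHom (lift hw')).op, ?_, ?_⟩, ?_, ?_⟩
  · exact congrArg (fun F => (Frm.ofHom F).op) H
  · exact congrArg (fun F => (Frm.ofHom F).op) H'
  · exact funext fun g => lift_gen hw g
  · exact funext fun g => lift_gen hw' g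

end Classifying

/-! ### Models in truth values: Dedekind cuts are real numbers -/

theorem isModel_prop_iff {G : Type} {T : Theory G} {v : G → Prop} :
    IsModel T v ↔ ∀ s ∈ T, (∀ g ∈ s.ant, v g) → ∃ D ∈ s.suc, ∀ g ∈ D, v g := by
  refine forall₂_congr fun s _ => ?_
  rw [← conj_prop v s.ant]
  simp only [iSup_Prop_eq, conj_prop, exists_prop, le_Prop_eq]

theorem exists_real_of_dedekindAx {G : Type} {lo up : ℚ → G} {v : G → Prop}
    (h : IsModel {s | DedekindAx lo up s} v) :
    ∃ x : ℝ, ∀ q : ℚ, (v (lo q) ↔ (q : ℝ) < x) ∧ (v (up q) ↔ x < q) := by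
  rw [isModel_prop_iff] at h
  have hlo : ∃ q, v (lo q) := by simpa using h _ .lo_inhabited
  have hup : ∃ q, v (up q) := by simpa using h _ .up_inhabited
  have lo_down : ∀ q q' : ℚ, q < q' → v (lo q') → v (lo q) := fun q q' hq => by
    simpa using h _ (.lo_down q q' hq)
  have up_up : ∀ q q' : ℚ, q < q' → v (up q) → v (up q') := fun q q' hq => by
    simpa using h _ (.up_up q q' hq)
  have lo_rounded : ∀ q, v (lo q) → ∃ q', q < q' ∧ v (lo q') := fun q hq => by
    obtain ⟨D, ⟨q', hq', rfl⟩, hD⟩ := h _ (.lo_rounded q) (by simpa using hq)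
    exact ⟨q', hq', by simpa using hD⟩
  have up_rounded : ∀ q, v (up q) → ∃ q', q' < q ∧ v (up q') := fun q hq => by
    obtain ⟨D, ⟨q', hq', rfl⟩, hD⟩ := h _ (.up_rounded q) (by simpa using hq)
    exact ⟨q', hq', by simpa using hD⟩
  have disjoint : ∀ q, v (lo q) → ¬ v (up q) := fun q h1 h2 => by
    simpa [h1, h2] using h _ (.disjoint q)
  have located : ∀ q r : ℚ, q < r → v (lo q) ∨ v (up r) := fun q r hq => by
    simpa using h _ (.located q r hq)
  have lo_lt_up : ∀ q r, v (lo q) → v (up r) → q < r := fun q r hq hr => by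
    by_contra! hle
    rcases hle.eq_or_lt with rfl | hlt
    · exact disjoint _ hq hr
    · exact disjoint _ hq (up_up _ _ hlt hr)
  set S : Set ℝ := {x | ∃ q : ℚ, v (lo q) ∧ (q : ℝ) = x} with hS
  have hne : S.Nonempty := hlo.imp' (fun q : ℚ => (q : ℝ)) fun q hq => ⟨q, hq, rfl⟩
  have hub : ∀ r, v (up r) → (r : ℝ) ∈ upperBounds S := by
    rintro r hr _ ⟨q, hq, rfl⟩
    exact_mod_cast (lo_lt_up q r hq hr).le
  have hbdd : BddAbove S := hup.imp' (fun q : ℚ => (q : ℝ)) hub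
  have key : ∀ q : ℚ, v (lo q) ↔ (q : ℝ) < sSup S := by
    refine fun q => ⟨fun hq => ?_, fun hq => ?_⟩
    · obtain ⟨q', hqq', hq'⟩ := lo_rounded q hq
      exact lt_of_lt_of_le (by exact_mod_cast hqq') (le_csSup hbdd ⟨q', hq', rfl⟩)
    · obtain ⟨_, ⟨q', hq', rfl⟩, hlt⟩ := exists_lt_of_lt_csSup hne hq
      exact lo_down q q' (by exact_mod_cast hlt) hq'
  refine ⟨sSup S, fun q => ⟨key q, fun hq => ?_, fun hq => ?_⟩⟩
  · obtain ⟨q', hqq', hq'⟩ := up_rounded q hq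
    exact lt_of_le_of_lt (csSup_le hne (hub q' hq')) (by exact_mod_cast hqq')
  · obtain ⟨r, hr, hrq⟩ := exists_rat_btwn hq
    refine (located r q (by exact_mod_cast hrq)).resolve_left fun h' => ?_
    exact lt_asymm hr ((key r).1 h')

theorem isModel_dedekindAx {G : Type} {lo up : ℚ → G} {v : G → Prop} {x : ℝ}
    (h : ∀ q : ℚ, (v (lo q) ↔ (q : ℝ) < x) ∧ (v (up q) ↔ x < q)) :
    IsModel {s | DedekindAx lo up s} v := by
  rw [isModel_prop_iff]
  intro s hs
  cases hs with
  | lo_inhabited => simpa [(h _).1] using exists_rat_lt x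
  | up_inhabited => simpa [(h _).2] using exists_rat_gt x
  | lo_down q q' hq =>
    have : (q : ℝ) < q' := by exact_mod_cast hq
    simpa [(h _).1] using this.trans
  | up_up q q' hq =>
    have : (q : ℝ) < q' := by exact_mod_cast hq
    simpa [(h _).2] using fun h' : x < q => h'.trans this
  | lo_rounded q =>
    intro h'
    obtain ⟨q', h1, h2⟩ := exists_rat_btwn ((h q).1.1 (h' _ (by simp)))
    exact ⟨_, ⟨q', by exact_mod_cast h1, rfl⟩, by simpa [(h _).1] using h2⟩
  | up_rounded q =>
    intro h'
    obtain ⟨q', h1, h2⟩ := exists_rat_btwn ((h q).2.1 (h' _ (by simp)))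
    exact ⟨_, ⟨q', by exact_mod_cast h2, rfl⟩, by simpa [(h _).2] using h1⟩
  | disjoint q =>
    simpa [(h _).1, (h _).2] using fun h' : (q : ℝ) < x => h'.le
  | located q r hq =>
    have : (q : ℝ) < r := by exact_mod_cast hq
    simpa [(h _).1, (h _).2] using (lt_or_ge (q : ℝ) x).imp_right fun h' => h'.trans_lt this

/-- The valuation `t` is the cut of the real number `α`. -/
def IsCutOf (t : RealSym → Prop) (α : ℝ) : Prop :=
  ∀ q : ℚ, (t (.gt q) ↔ (q : ℝ) < α) ∧ (t (.lt q) ↔ α < q)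

theorem IsCutOf.unique {t t' : RealSym → Prop} {α : ℝ} (h : IsCutOf t α) (h' : IsCutOf t' α)
    (g : RealSym) : t g ↔ t' g := by
  cases g with
  | gt q => rw [(h q).1, (h' q).1]
  | lt q => rw [(h q).2, (h' q).2]

theorem isModel_union {G : Type} {T T' : Theory G} {L : Type*} [Order.Frame L] {v : G → L} :
    IsModel (T ∪ T') v ↔ IsModel T v ∧ IsModel T' v := by
  simp only [IsModel, Set.mem_union, or_imp, forall_and]

theorem isModel_realTheory_iff {t : RealSym → Prop} :
    IsModel realTheory t ↔ ∃ α, IsCutOf t α :=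
  ⟨exists_real_of_dedekindAx, fun ⟨_, h⟩ => isModel_dedekindAx h⟩

theorem isModel_Icc01_iff {t : RealSym → Prop} :
    IsModel Icc01 t ↔ ∃ α ∈ Set.Icc (0 : ℝ) 1, IsCutOf t α := by
  rw [Icc01, isModel_union, isModel_realTheory_iff, ← exists_and_right]
  refine exists_congr fun α => ?_
  rw [and_comm]
  refine and_congr_left fun h => ?_
  have h0 := (h 0).2
  have h1 := (h 1).1
  simp [isModel_prop_iff, h0, h1]

theorem isModel_Ioc01_iff {t : RealSym → Prop} :
    IsModel Ioc01 t ↔ ∃ α ∈ Set.Ioc (0 : ℝ) 1, IsCutOf t α := by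
  rw [Ioc01, isModel_union, isModel_realTheory_iff, ← exists_and_right]
  refine exists_congr fun α => ?_
  rw [and_comm]
  refine and_congr_left fun h => ?_
  have h0 := (h 0).1
  have h1 := (h 1).1
  simp [isModel_prop_iff, h0, h1]

/-! ### Models in truth values: absolute values -/

/-- The valuation `N` describes the real-valued function `f`. -/
def IsNormOf (N : AbsSym → Prop) (f : ℚ → ℝ) : Prop :=
  ∀ x q : ℚ, (N (.gt q x) ↔ (q : ℝ) < f x) ∧ (N (.lt x q) ↔ f x < q)

theorem IsNormOf.unique {N N' : AbsSym → Prop} {f : ℚ → ℝ} (h : IsNormOf N f)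
    (h' : IsNormOf N' f) (g : AbsSym) : N g ↔ N' g := by
  cases g with
  | gt q x => rw [(h x q).1, (h' x q).1]
  | lt x q => rw [(h x q).2, (h' x q).2]

/-- Translates between products of upper sections and products of reals. By continuity `a` can be
enlarged to a positive rational `r` with `r * b < q`; then `s` is chosen between `b` and `q / r`. -/
theorem exists_rat_mul_le_of_mul_lt {a b : ℝ} (ha : 0 ≤ a) (hb : 0 ≤ b) {q : ℚ}
    (h : a * b < q) : ∃ r s : ℚ, 0 < r ∧ 0 < s ∧ r * s ≤ q ∧ a < r ∧ b < s := by
  have hc : Filter.Tendsto (fun e : ℝ => (a + e) * b) (nhdsWithin 0 (Set.Ioi 0))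
      (nhds (a * b)) := by
    refine tendsto_nhdsWithin_of_tendsto_nhds ?_
    have : Continuous fun e : ℝ => (a + e) * b := by fun_prop
    simpa using this.tendsto 0
  obtain ⟨e, he, he0 : 0 < e⟩ := ((hc.eventually (gt_mem_nhds h)).and self_mem_nhdsWithin).exists
  obtain ⟨r, hr, hre⟩ := exists_rat_btwn (lt_add_of_pos_right a he0)
  have hr0 : (0 : ℝ) < r := ha.trans_lt hr
  have hrb : b < q / r := by
    rw [lt_div_iff₀ hr0, mul_comm]
    exact (mul_le_mul_of_nonneg_right hre.le hb).trans_lt he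
  obtain ⟨s, hs, hsq⟩ := exists_rat_btwn hrb
  rw [lt_div_iff₀ hr0, mul_comm] at hsq
  exact ⟨r, s, by exact_mod_cast hr0, by exact_mod_cast hb.trans_lt hs, by exact_mod_cast hsq.le,
    hr, hs⟩

theorem exists_absoluteValue_of_isModel {N : AbsSym → Prop} (h : IsModel absTheory N) :
    ∃ f : AbsoluteValue ℚ ℝ, IsNormOf N f := by
  have hded : ∀ x, ∃ y : ℝ, ∀ q : ℚ,
      (N (.gt q x) ↔ (q : ℝ) < y) ∧ (N (.lt x q) ↔ y < q) := fun x =>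
    exists_real_of_dedekindAx (lo := fun q => AbsSym.gt q x) (up := fun q => AbsSym.lt x q)
      fun s hs => h s (AbsAx.dedekind x s hs)
  choose f hf using hded
  have hgt : ∀ q x, N (.gt q x) ↔ (q : ℝ) < f x := fun q x => (hf x q).1
  have hlt : ∀ x q, N (.lt x q) ↔ f x < q := fun x q => (hf x q).2
  rw [isModel_prop_iff] at h
  have nonneg : ∀ x, 0 ≤ f x := fun x => by simpa [hlt] using h _ (.nonneg x)
  have zero : f 0 = 0 := by
    refine le_antisymm (le_of_forall_lt_rat_imp_le fun q hq => ?_) (nonneg 0)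
    have : f 0 < q := by simpa [hlt] using h _ (.zero q (by exact_mod_cast hq))
    exact this.le
  have mul_le : ∀ x y (r s : ℚ), 0 < r → 0 < s → f x < r → f y < s → f (x * y) < r * s :=
    fun x y r s hr hs => by simpa [hlt] using h _ (.mul_le x y r s hr hs)
  have le_mul : ∀ x y (q : ℚ), f (x * y) < q →
      ∃ r s : ℚ, 0 < r ∧ 0 < s ∧ r * s ≤ q ∧ f x < r ∧ f y < s := fun x y q hq => by
    obtain ⟨D, ⟨r, s, hr, hs, hrs, rfl⟩, hD⟩ := h _ (.le_mul x y q) (by simpa [hlt] using hq)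
    exact ⟨r, s, hr, hs, hrs, by simpa [hlt] using hD⟩
  have add_lt : ∀ x y (r s : ℚ), f x < r → f y < s → f (x + y) < r + s :=
    fun x y r s => by simpa [hlt] using h _ (.triangle x y r s)
  have pos : ∀ x, x = 0 ∨ 0 < f x := fun x => by
    obtain ⟨D, hD | rfl, hD'⟩ := h _ (.posDef x) (by simp)
    · exact .inl hD.1
    · exact .inr (by simpa [hgt] using hD')
  refine ⟨⟨⟨f, fun x y => ?_⟩, nonneg, fun x => ?_, fun x y => ?_⟩, hf⟩
  · apply le_antisymm
    · refine le_of_forall_lt_rat_imp_le fun q hq => ?_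
      obtain ⟨r, s, hr, hs, hrs, h1, h2⟩ := exists_rat_mul_le_of_mul_lt (nonneg x) (nonneg y) hq
      exact (mul_le x y r s hr hs h1 h2).le.trans (by exact_mod_cast hrs)
    · refine le_of_forall_lt_rat_imp_le fun q hq => ?_
      obtain ⟨r, s, hr, hs, hrs, h1, h2⟩ := le_mul x y q hq
      have hr' : (0 : ℝ) ≤ r := by exact_mod_cast hr.le
      exact (mul_le_mul h1.le h2.le (nonneg y) hr').trans (by exact_mod_cast hrs)
  · exact ⟨fun hx => (pos x).resolve_right fun h' => h'.ne' hx, fun hx => hx ▸ zero⟩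
  · change f (x + y) ≤ f x + f y
    by_contra! hlt'
    -- The gap left by a failing triangle inequality is filled by rational bounds `r`, `s` with `r +
    -- s < f (x + y)`.
    obtain ⟨r, hr, hr'⟩ := exists_rat_btwn (show f x < f (x + y) - f y by linarith)
    obtain ⟨s, hs, hs'⟩ := exists_rat_btwn (show f y < f (x + y) - r by linarith)
    have := add_lt x y r s hr hs
    linarith

theorem isModel_absTheory {N : AbsSym → Prop} {f : AbsoluteValue ℚ ℝ} (h : IsNormOf N f) :
    IsModel absTheory N := by
  have hgt : ∀ q x, N (.gt q x) ↔ (q : ℝ) < f x := fun q x => (h x q).1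
  have hlt : ∀ x q, N (.lt x q) ↔ f x < q := fun x q => (h x q).2
  rw [isModel_prop_iff]
  intro s hs
  cases hs with
  | dedekind x s hs =>
    exact isModel_prop_iff.1 (isModel_dedekindAx (lo := fun q => AbsSym.gt q x)
      (up := fun q => AbsSym.lt x q) (h x)) s hs
  | nonneg x => simp [hlt]
  | zero q hq => simpa [hlt] using hq
  | one_le q hq => simpa [hlt] using (by exact_mod_cast hq : (1 : ℝ) < q)
  | le_one => simp [hlt]
  | mul_le x y r s hr hs =>
    have hr' : (0 : ℝ) < r := by exact_mod_cast hr
    simpa [hlt] using fun h1 h2 => mul_lt_mul'' h1 h2 (f.nonneg x) (f.nonneg y)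
  | le_mul x y q =>
    intro hq
    have hq' : f x * f y < q := by simpa [hlt] using hq
    obtain ⟨r, s, hr, hs, hrs, h1, h2⟩ :=
      exists_rat_mul_le_of_mul_lt (f.nonneg x) (f.nonneg y) hq'
    exact ⟨_, ⟨r, s, hr, hs, hrs, rfl⟩, by simp [hlt, h1, h2]⟩
  | triangle x y r s =>
    simpa [hlt] using fun h1 h2 => (f.add_le x y).trans_lt (add_lt_add h1 h2)
  | posDef x =>
    intro _
    by_cases hx : x = 0
    · exact ⟨∅, .inl ⟨hx, rfl⟩, by simp⟩
    · exact ⟨_, .inr rfl, by simp [hgt, hx]⟩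

/-! ### Archimedean absolute values in truth values -/

/-- The power `|x|_∞ ^ α`, with value `0` at `0`. -/
def absPow (α : ℝ) (x : ℚ) : ℝ := if x = 0 then 0 else ((|x| : ℚ) : ℝ) ^ α

theorem absPow_zero (α : ℝ) : absPow α 0 = 0 := if_pos rfl

theorem absPow_of_ne (α : ℝ) {x : ℚ} (hx : x ≠ 0) : absPow α x = ((|x| : ℚ) : ℝ) ^ α := if_neg hx

theorem absPow_pos (α : ℝ) {x : ℚ} (hx : x ≠ 0) : 0 < absPow α x := by
  rw [absPow_of_ne α hx]
  exact Real.rpow_pos_of_pos (by exact_mod_cast abs_pos.2 hx) _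

theorem absPow_nonneg (α : ℝ) (x : ℚ) : 0 ≤ absPow α x := by
  by_cases hx : x = 0
  · rw [hx, absPow_zero]
  · exact (absPow_pos α hx).le

theorem absPow_two (α : ℝ) : absPow α 2 = 2 ^ α := by
  rw [absPow_of_ne α two_ne_zero, abs_two, Rat.cast_ofNat]

/-- The powers of the usual absolute value with exponent in `[0,1]` are absolute values. -/
def absPowAbsoluteValue {α : ℝ} (hα : α ∈ Set.Icc (0 : ℝ) 1) : AbsoluteValue ℚ ℝ where
  toFun := absPow α
  map_mul' x y := by
    by_cases hx : x = 0
    · simp [hx, absPow_zero]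
    by_cases hy : y = 0
    · simp [hy, absPow_zero]
    rw [absPow_of_ne α hx, absPow_of_ne α hy, absPow_of_ne α (mul_ne_zero hx hy), abs_mul,
      Rat.cast_mul, Real.mul_rpow (by exact_mod_cast abs_nonneg x) (by exact_mod_cast abs_nonneg y)]
  nonneg' := absPow_nonneg α
  eq_zero' x := ⟨fun h => by_contra fun hx => (absPow_pos α hx).ne' h, fun h => h ▸ absPow_zero α⟩
  add_le' x y := by
    by_cases hx : x = 0
    · simp [hx, absPow_zero]
    by_cases hy : y = 0
    · simp [hy, absPow_zero]
    by_cases hxy : x + y = 0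
    · rw [hxy, absPow_zero]
      exact add_nonneg (absPow_nonneg α x) (absPow_nonneg α y)
    rw [absPow_of_ne α hx, absPow_of_ne α hy, absPow_of_ne α hxy]
    have h0 : ∀ z : ℚ, (0 : ℝ) ≤ ((|z| : ℚ) : ℝ) := fun z => by exact_mod_cast abs_nonneg z
    -- Subadditivity of `u ↦ u ^ α` on nonnegative reals; here `α ≤ 1` is needed.
    refine le_trans ?_ (Real.rpow_add_le_add_rpow (h0 x) (h0 y) hα.1 hα.2)
    exact Real.rpow_le_rpow (h0 _) (by exact_mod_cast abs_add_le x y) hα.1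

theorem one_le_absPow {α : ℝ} (hα : 0 ≤ α) {n : ℤ} (hn : n ≠ 0) : 1 ≤ absPow α n := by
  rw [absPow_of_ne α (by exact_mod_cast hn)]
  exact Real.one_le_rpow (by exact_mod_cast Int.one_le_abs hn) hα

/-- Ostrowski's theorem: being unbounded on the naturals, `f` is equivalent to the usual absolute
value, so it is a power with exponent `c > 0`. Then `2 ^ c = f 2 ≤ f 1 + f 1 = 2` gives `c ≤ 1`. -/
theorem exists_eq_absPow_of_one_lt (f : AbsoluteValue ℚ ℝ) {n : ℤ} (hn : 1 < f n) :
    ∃ α ∈ Set.Ioc (0 : ℝ) 1, ∀ x, f x = absPow α x := by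
  have hunb : ¬ ∀ n : ℕ, f n ≤ 1 := fun h => by
    refine (h n.natAbs).not_gt ?_
    rcases Int.natAbs_eq n with h' | h'
    · rw [h'] at hn
      simpa using hn
    · rw [h'] at hn
      simpa using hn
  obtain ⟨c, hc0, hc⟩ := AbsoluteValue.isEquiv_iff_exists_rpow_eq.1
    (Rat.AbsoluteValue.equiv_real_of_unbounded hunb).symm
  have hf : ∀ x, f x = absPow c x := fun x => by
    rw [← congrFun hc x, absPow]
    split_ifs with hx
    · simp [hx, hc0.ne']
    · simp
  refine ⟨c, ⟨hc0, ?_⟩, hf⟩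
  have h2 : f 2 ≤ 2 := by
    have := f.add_le 1 1
    rwa [one_add_one_eq_two, map_one, one_add_one_eq_two] at this
  rw [hf, absPow_two] at h2
  exact (Real.rpow_le_rpow_left_iff one_lt_two).1 (h2.trans_eq (Real.rpow_one 2).symm)

/-- If no integer has value above `1`, all nonzero integers have value exactly `1`, and by
multiplicativity so do all nonzero fractions; the exponent is then `0`. -/
theorem exists_eq_absPow_of_one_le (f : AbsoluteValue ℚ ℝ) (hf : ∀ n : ℤ, n ≠ 0 → 1 ≤ f n) :
    ∃ α ∈ Set.Icc (0 : ℝ) 1, ∀ x, f x = absPow α x := by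
  by_cases h : ∃ n : ℤ, 1 < f n
  · obtain ⟨n, hn⟩ := h
    obtain ⟨α, hα, h⟩ := exists_eq_absPow_of_one_lt f hn
    exact ⟨α, Set.Ioc_subset_Icc_self hα, h⟩
  · push Not at h
    refine ⟨0, by simp, fun x => ?_⟩
    by_cases hx : x = 0
    · rw [hx, absPow_zero, map_zero]
    · have h1 : ∀ n : ℤ, n ≠ 0 → f n = 1 := fun n hn => le_antisymm (h n) (hf n hn)
      have h2 := h1 x.den (by exact_mod_cast x.den_ne_zero)
      rw [absPow_of_ne 0 hx, Real.rpow_zero, ← Rat.num_div_den x, map_div₀,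
        h1 x.num (Rat.num_ne_zero.2 hx)]
      rw [Int.cast_natCast] at h2
      rw [h2, div_one]

theorem isModel_archTheory_iff {N : AbsSym → Prop} :
    IsModel archTheory N ↔ ∃ α ∈ Set.Icc (0 : ℝ) 1, IsNormOf N (absPow α) := by
  rw [archTheory, isModel_union, isModel_prop_iff (T := {s | _})]
  constructor
  · rintro ⟨h, h'⟩
    obtain ⟨f, hf⟩ := exists_absoluteValue_of_isModel h
    obtain ⟨α, hα, hα'⟩ := exists_eq_absPow_of_one_le f fun n hn => by
      simpa [(hf _ _).2] using h' _ ⟨n, hn, rfl⟩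
    exact ⟨α, hα, funext hα' ▸ hf⟩
  · rintro ⟨α, hα, h⟩
    refine ⟨isModel_absTheory (f := absPowAbsoluteValue hα) h, ?_⟩
    rintro _ ⟨n, hn, rfl⟩
    simpa [(h _ _).2] using one_le_absPow hα.1 hn

theorem isModel_archPosTheory_iff {N : AbsSym → Prop} :
    IsModel archPosTheory N ↔ ∃ α ∈ Set.Ioc (0 : ℝ) 1, IsNormOf N (absPow α) := by
  rw [archPosTheory, isModel_union, isModel_prop_iff (T := {_})]
  constructor
  · rintro ⟨h, h'⟩
    obtain ⟨f, hf⟩ := exists_absoluteValue_of_isModel h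
    obtain ⟨_, ⟨n, hn, rfl⟩, hn'⟩ := h' _ rfl (by simp)
    obtain ⟨α, hα, hα'⟩ := exists_eq_absPow_of_one_lt f (n := n) (by simpa [(hf _ _).1] using hn')
    exact ⟨α, hα, funext hα' ▸ hf⟩
  · rintro ⟨α, hα, h⟩
    refine ⟨isModel_absTheory (f := absPowAbsoluteValue (Set.Ioc_subset_Icc_self hα)) h, ?_⟩
    rintro _ rfl _
    refine ⟨_, ⟨2, two_ne_zero, rfl⟩, ?_⟩
    simpa [(h _ _).1, absPow_two] using Real.one_lt_rpow one_lt_two hα.1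

/-! ### The logarithm and power maps -/

section Maps

variable {L M : Type*} [Order.Frame L] [Order.Frame M]

/-- The real `log₂ |2|` of an absolute value. -/
def logTwo (N : AbsSym → L) : RealSym → L
  | .lt q => ⨆ (s : ℚ) (_ : (s : ℝ) < (2 : ℝ) ^ (q : ℝ)), N (.lt 2 s)
  | .gt q => ⨆ (s : ℚ) (_ : (2 : ℝ) ^ (q : ℝ) < (s : ℝ)), N (.gt s 2)

/-- The power of the usual absolute value with exponent a given real. -/
def powOf (t : RealSym → L) : AbsSym → L
  | .lt x q => if x = 0 then ⨆ _ : 0 < q, ⊤ else ⨆ (a : ℚ) (b : ℚ)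
      (_ : ((|x| : ℚ) : ℝ) ^ (a : ℝ) < (q : ℝ) ∧ ((|x| : ℚ) : ℝ) ^ (b : ℝ) < (q : ℝ)),
        t (.gt a) ⊓ t (.lt b)
  | .gt q x => if x = 0 then ⨆ _ : q < 0, ⊤ else ⨆ (a : ℚ) (b : ℚ)
      (_ : (q : ℝ) < ((|x| : ℚ) : ℝ) ^ (a : ℝ) ∧ (q : ℝ) < ((|x| : ℚ) : ℝ) ^ (b : ℝ)),
        t (.gt a) ⊓ t (.lt b)

theorem isLogTwo_logTwo (N : AbsSym → L) : IsLogTwo (logTwo N) N := fun _ => ⟨rfl, rfl⟩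

theorem isAbsPow_powOf (t : RealSym → L) : IsAbsPow (powOf t) t :=
  ⟨fun _ hx _ => ⟨if_neg hx, if_neg hx⟩,
    fun _ => by simp only [powOf, if_true, and_self]⟩

theorem map_logTwo (F : FrameHom L M) (N : AbsSym → L) (g : RealSym) :
    F (logTwo N g) = logTwo (fun g => F (N g)) g := by
  cases g <;> simp only [logTwo, map_iSup]

/-- Only joins and finite meets occur; the case distinction concerns the rational `x`, not a truth
value in the frame. -/
theorem map_powOf (F : FrameHom L M) (t : RealSym → L) (g : AbsSym) :
    F (powOf t g) = powOf (fun g => F (t g)) g := by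
  cases g <;> simp only [powOf] <;> split_ifs <;> simp only [map_iSup, map_inf, map_top]

end Maps

theorem IsNormOf.isCutOf_logTwo {N : AbsSym → Prop} {α : ℝ} (h : IsNormOf N (absPow α)) :
    IsCutOf (logTwo N) α := by
  intro q
  have hlt : (2 : ℝ) ^ α < 2 ^ (q : ℝ) ↔ α < q := Real.rpow_lt_rpow_left_iff one_lt_two
  have hgt : (2 : ℝ) ^ (q : ℝ) < 2 ^ α ↔ q < α := Real.rpow_lt_rpow_left_iff one_lt_two
  simp only [logTwo, iSup_Prop_eq, (h _ _).1, (h _ _).2, absPow_two, exists_prop, ← hlt, ← hgt]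
  exact ⟨⟨fun ⟨s, h1, h2⟩ => h1.trans h2, exists_rat_btwn⟩, ⟨fun ⟨s, h1, h2⟩ => h2.trans h1,
    fun h' => (exists_rat_btwn h').imp fun s hs => hs.symm⟩⟩

theorem exists_rat_btwn_of_isOpen {U : Set ℝ} (hU : IsOpen U) {α : ℝ} (hα : α ∈ U) :
    ∃ a b : ℚ, ((a : ℝ) ∈ U ∧ (b : ℝ) ∈ U) ∧ (a : ℝ) < α ∧ α < b := by
  obtain ⟨e, he, hball⟩ := Metric.isOpen_iff.1 hU α hα
  obtain ⟨a, ha, ha'⟩ := exists_rat_btwn (sub_lt_self α he)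
  obtain ⟨b, hb, hb'⟩ := exists_rat_btwn (lt_add_of_pos_right α he)
  refine ⟨a, b, ⟨hball ?_, hball ?_⟩, ha', hb⟩ <;> rw [Real.ball_eq_Ioo] <;> constructor <;> linarith

/-- The unordered interval covers both `1 ≤ y`, where the power increases with the exponent, and `y
≤ 1`, where it decreases. -/
theorem rpow_mem_uIcc {y a b c : ℝ} (hy : 0 < y) (hab : a < b) (hbc : b < c) :
    y ^ b ∈ Set.uIcc (y ^ a) (y ^ c) := by
  rcases le_total 1 y with h | h
  · exact Set.mem_uIcc.2 (.inl ⟨Real.rpow_le_rpow_of_exponent_le h hab.le,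
      Real.rpow_le_rpow_of_exponent_le h hbc.le⟩)
  · exact Set.mem_uIcc.2 (.inr ⟨Real.rpow_le_rpow_of_exponent_ge hy h hbc.le,
      Real.rpow_le_rpow_of_exponent_ge hy h hab.le⟩)

theorem IsCutOf.isNormOf_powOf {t : RealSym → Prop} {α : ℝ} (h : IsCutOf t α) :
    IsNormOf (powOf t) (absPow α) := by
  intro x q
  by_cases hx : x = 0
  · simp [powOf, hx, absPow_zero]
  have hy : (0 : ℝ) < ((|x| : ℚ) : ℝ) := by exact_mod_cast abs_pos.2 hx
  have hcont : Continuous fun a : ℝ => ((|x| : ℚ) : ℝ) ^ a := Real.continuous_const_rpow hy.ne'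
  simp only [powOf, if_neg hx, absPow_of_ne α hx, iSup_Prop_eq, inf_Prop_eq, (h _).1, (h _).2,
    exists_prop]
  refine ⟨⟨?_, fun h' => ?_⟩, ⟨?_, fun h' => ?_⟩⟩
  · rintro ⟨a, b, ⟨h1, h2⟩, ha, hb⟩
    exact (lt_min h1 h2).trans_le (rpow_mem_uIcc hy ha hb).1
  · exact exists_rat_btwn_of_isOpen (isOpen_lt continuous_const hcont) h'
  · rintro ⟨a, b, ⟨h1, h2⟩, ha, hb⟩
    exact (rpow_mem_uIcc hy ha hb).2.trans_lt (max_lt h1 h2)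
  · exact exists_rat_btwn_of_isOpen (isOpen_lt hcont continuous_const) h'

/-! ### Countability of the axioms -/

theorem countable_dedekindAx {G : Type} (lo up : ℚ → G) : {s | DedekindAx lo up s}.Countable := by
  classical
  -- Dropping the side conditions makes every axiom scheme a single sequent or the range of a map
  -- from tuples of rationals.
  refine Set.Countable.mono (s₂ :=
    {⟨∅, {D | ∃ q, D = {lo q}}⟩} ∪ {⟨∅, {D | ∃ q, D = {up q}}⟩} ∪
    Set.range (fun p : ℚ × ℚ => ⟨{lo p.2}, {{lo p.1}}⟩) ∪
    Set.range (fun p : ℚ × ℚ => ⟨{up p.1}, {{up p.2}}⟩) ∪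
    Set.range (fun q : ℚ => ⟨{lo q}, {D | ∃ q', q < q' ∧ D = {lo q'}}⟩) ∪
    Set.range (fun q : ℚ => ⟨{up q}, {D | ∃ q', q' < q ∧ D = {up q'}}⟩) ∪
    Set.range (fun q : ℚ => ⟨{lo q, up q}, ∅⟩) ∪
    Set.range (fun p : ℚ × ℚ => ⟨∅, {{lo p.1}, {up p.2}}⟩)) ?_ ?_
  · intro s hs
    simp only [Set.mem_union, Set.mem_singleton_iff, Set.mem_range, Prod.exists]
    cases hs with
    | lo_inhabited => simp
    | up_inhabited => simp
    | lo_down q q' h => exact .inl (.inl (.inl (.inl (.inl (.inr ⟨q, q', rfl⟩)))))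
    | up_up q q' h => exact .inl (.inl (.inl (.inl (.inr ⟨q, q', rfl⟩))))
    | lo_rounded q => exact .inl (.inl (.inl (.inr ⟨q, rfl⟩)))
    | up_rounded q => exact .inl (.inl (.inr ⟨q, rfl⟩))
    | disjoint q => exact .inl (.inr ⟨q, by congr⟩)
    | located q r h => exact .inr ⟨q, r, rfl⟩
  · simp only [Set.countable_union, Set.countable_singleton, Set.countable_range, and_self]

theorem countable_absTheory : absTheory.Countable := by
  classical
  refine Set.Countable.mono (s₂ :=
    (⋃ x, {s | DedekindAx (fun q => AbsSym.gt q x) (fun q => AbsSym.lt x q) s}) ∪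
    Set.range (fun x : ℚ => ⟨{.lt x 0}, ∅⟩) ∪
    Set.range (fun q : ℚ => ⟨∅, {{.lt 0 q}}⟩) ∪
    Set.range (fun q : ℚ => ⟨∅, {{.lt 1 q}}⟩) ∪
    {⟨{.lt 1 1}, ∅⟩} ∪
    Set.range (fun p : ℚ × ℚ × ℚ × ℚ =>
      ⟨{.lt p.1 p.2.2.1, .lt p.2.1 p.2.2.2}, {{.lt (p.1 * p.2.1) (p.2.2.1 * p.2.2.2)}}⟩) ∪
    Set.range (fun p : ℚ × ℚ × ℚ => ⟨{.lt (p.1 * p.2.1) p.2.2}, {D | ∃ r s : ℚ,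
      0 < r ∧ 0 < s ∧ r * s ≤ p.2.2 ∧ D = {.lt p.1 r, .lt p.2.1 s}}⟩) ∪
    Set.range (fun p : ℚ × ℚ × ℚ × ℚ =>
      ⟨{.lt p.1 p.2.2.1, .lt p.2.1 p.2.2.2}, {{.lt (p.1 + p.2.1) (p.2.2.1 + p.2.2.2)}}⟩) ∪
    Set.range (fun x : ℚ => ⟨∅, {D | (x = 0 ∧ D = ∅) ∨ D = {.gt 0 x}}⟩)) ?_ ?_
  · intro s hs
    simp only [Set.mem_union, Set.mem_singleton_iff, Set.mem_range, Prod.exists, Set.mem_iUnion]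
    cases hs with
    | dedekind x s h => exact .inl (.inl (.inl (.inl (.inl (.inl (.inl (.inl ⟨x, h⟩)))))))
    | nonneg x => exact .inl (.inl (.inl (.inl (.inl (.inl (.inl (.inr ⟨x, rfl⟩)))))))
    | zero q h => exact .inl (.inl (.inl (.inl (.inl (.inl (.inr ⟨q, rfl⟩))))))
    | one_le q h => exact .inl (.inl (.inl (.inl (.inl (.inr ⟨q, rfl⟩)))))
    | le_one => exact .inl (.inl (.inl (.inl (.inr rfl))))
    | mul_le x y r s hr hs => exact .inl (.inl (.inl (.inr ⟨x, y, r, s, by congr⟩)))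
    | le_mul x y q =>
      refine .inl (.inl (.inr ⟨x, y, q, ?_⟩))
      congr! 12
    | triangle x y r s => exact .inl (.inr ⟨x, y, r, s, by congr⟩)
    | posDef x => exact .inr ⟨x, rfl⟩
  · simp only [Set.countable_union, Set.countable_singleton, Set.countable_range, and_true]
    exact Set.countable_iUnion fun x => countable_dedekindAx _ _

theorem countable_archTheory : archTheory.Countable := by
  refine countable_absTheory.union ((Set.countable_range
    fun n : ℤ => (⟨{.lt n 1}, ∅⟩ : Sequent AbsSym)).mono ?_)
  rintro s ⟨n, -, rfl⟩
  exact ⟨n, rfl⟩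

theorem countable_archPosTheory : archPosTheory.Countable :=
  countable_absTheory.union (Set.countable_singleton _)

theorem countable_Icc01 : Icc01.Countable :=
  (countable_dedekindAx _ _).union ((Set.countable_singleton _).insert _)

theorem countable_Ioc01 : Ioc01.Countable :=
  (countable_dedekindAx _ _).union ((Set.countable_singleton _).insert _)

/-! ### The isomorphisms -/

section Iso

variable {T : Theory AbsSym} {T' : Theory RealSym} {S : Set ℝ}

theorem isModel_logTwo_gen (hT : T.Countable)
    (hN : ∀ N : AbsSym → Prop, IsModel T N → ∃ α ∈ S, IsNormOf N (absPow α))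
    (ht : ∀ t : RealSym → Prop, (∃ α ∈ S, IsCutOf t α) → IsModel T' t) :
    IsModel T' (logTwo (gen T)) := by
  refine isModel_of_points hT fun p hp => ?_
  simp only [map_logTwo, lift_gen]
  obtain ⟨α, hα, h⟩ := hN p hp
  exact ht _ ⟨α, hα, h.isCutOf_logTwo⟩

theorem isModel_powOf_gen (hT' : T'.Countable)
    (hN : ∀ N : AbsSym → Prop, (∃ α ∈ S, IsNormOf N (absPow α)) → IsModel T N)
    (ht : ∀ t : RealSym → Prop, IsModel T' t → ∃ α ∈ S, IsCutOf t α) :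
    IsModel T (powOf (gen T')) := by
  refine isModel_of_points hT' fun p hp => ?_
  simp only [map_powOf, lift_gen]
  obtain ⟨α, hα, h⟩ := ht p hp
  exact hN _ ⟨α, hα, h.isNormOf_powOf⟩

theorem powOf_logTwo_gen (hT : T.Countable)
    (hN : ∀ N : AbsSym → Prop, IsModel T N → ∃ α ∈ S, IsNormOf N (absPow α)) :
    powOf (logTwo (gen T)) = gen T := by
  refine funext fun g => eq_of_points hT fun p hp => ?_
  simp only [map_powOf, map_logTwo, lift_gen]
  obtain ⟨α, -, h⟩ := hN p hp
  exact h.isCutOf_logTwo.isNormOf_powOf.unique h g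

theorem logTwo_powOf_gen (hT' : T'.Countable)
    (ht : ∀ t : RealSym → Prop, IsModel T' t → ∃ α ∈ S, IsCutOf t α) :
    logTwo (powOf (gen T')) = gen T' := by
  refine funext fun g => eq_of_points hT' fun p hp => ?_
  simp only [map_powOf, map_logTwo, lift_gen]
  obtain ⟨α, -, h⟩ := ht p hp
  exact h.isNormOf_powOf.isCutOf_logTwo.unique h g

/-- One argument serves both intervals: `S` is the set of exponents that parametrises the points on
both sides. -/
theorem exists_iso_log_pow (hT : T.Countable) (hT' : T'.Countable)
    (hN : ∀ N : AbsSym → Prop, IsModel T N ↔ ∃ α ∈ S, IsNormOf N (absPow α))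
    (ht : ∀ t : RealSym → Prop, IsModel T' t ↔ ∃ α ∈ S, IsCutOf t α) :
    ∃ e : space T ≅ space T', IsLogTwo (pull e.hom) (gen T) ∧ IsAbsPow (pull e.inv) (gen T') := by
  have hN1 := fun N => (hN N).1
  have ht1 := fun t => (ht t).1
  obtain ⟨e, h1, h2⟩ := exists_iso (isModel_logTwo_gen hT hN1 fun t => (ht t).2)
    (isModel_powOf_gen hT' (fun N => (hN N).2) ht1)
    (fun g => by simp only [map_powOf, lift_gen]; exact congrFun (powOf_logTwo_gen hT hN1) g)
    (fun g => by simp only [map_logTwo, lift_gen]; exact congrFun (logTwo_powOf_gen hT' ht1) g)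
  exact ⟨e, h1 ▸ isLogTwo_logTwo _, h2 ▸ isAbsPow_powOf _⟩

/-- `N` is the image of the generic model under `lift h`, and `logTwo` commutes with `lift h`; hence
no points of `L` are required. -/
theorem isModel_logTwo {L : Type*} [Order.Frame L] {N : AbsSym → L} (h : IsModel T N)
    (hT : T.Countable)
    (hN : ∀ N : AbsSym → Prop, IsModel T N → ∃ α ∈ S, IsNormOf N (absPow α))
    (ht : ∀ t : RealSym → Prop, (∃ α ∈ S, IsCutOf t α) → IsModel T' t) :
    IsModel T' (logTwo N) := by
  have := (isModel_logTwo_gen hT hN ht).map (lift h)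
  simpa only [map_logTwo, lift_gen] using this

theorem powOf_logTwo {L : Type*} [Order.Frame L] {N : AbsSym → L} (h : IsModel T N)
    (hT : T.Countable)
    (hN : ∀ N : AbsSym → Prop, IsModel T N → ∃ α ∈ S, IsNormOf N (absPow α)) :
    powOf (logTwo N) = N := by
  funext g
  have := congrArg (lift h) (congrFun (powOf_logTwo_gen hT hN) g)
  simpa only [map_powOf, map_logTwo, lift_gen] using this

end Iso

end PointFree

end

theorem proposition5p7 :
    -- the space of Archimedean absolute values is isomorphic to `[0,1]`,
    -- through `|·| ↦ log₂ |2|` and `t ↦ |·|_∞ ^ t`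
    (∃ e : PointFree.space PointFree.archTheory ≅ PointFree.space PointFree.Icc01,
      PointFree.IsLogTwo (PointFree.pull e.hom) (PointFree.gen PointFree.archTheory) ∧
      PointFree.IsAbsPow (PointFree.pull e.inv) (PointFree.gen PointFree.Icc01)) ∧
    -- the space of nontrivial Archimedean absolute values is isomorphic to `(0,1]`
    (∃ e : PointFree.space PointFree.archPosTheory ≅ PointFree.space PointFree.Ioc01,
      PointFree.IsLogTwo (PointFree.pull e.hom) (PointFree.gen PointFree.archPosTheory) ∧
      PointFree.IsAbsPow (PointFree.pull e.inv) (PointFree.gen PointFree.Ioc01)) ∧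
    -- every generalised point of the first space is `|·|_∞ ^ t` with `t` in `[0,1]`,
    -- and `t > 0` if it is nontrivial
    (∀ (L : Type*) [Order.Frame L] (N : PointFree.AbsSym → L),
      PointFree.IsModel PointFree.archTheory N →
      ∃ t : PointFree.RealSym → L, PointFree.IsModel PointFree.Icc01 t ∧
        PointFree.IsLogTwo t N ∧ PointFree.IsAbsPow N t ∧
        (PointFree.IsModel PointFree.archPosTheory N → PointFree.IsModel PointFree.Ioc01 t)) ∧
    -- the same for ordinary real-valued absolute values
    (∀ f : AbsoluteValue ℚ ℝ, (∀ n : ℤ, n ≠ 0 → 1 ≤ f n) →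
      ∃ α : ℝ, 0 ≤ α ∧ α ≤ 1 ∧ α = Real.logb 2 (f 2) ∧
        (∀ x : ℚ, x ≠ 0 → f x = ((|x| : ℚ) : ℝ) ^ α) ∧
        ((∃ n : ℤ, n ≠ 0 ∧ 1 < f n) → 0 < α)) := by
  open PointFree in
  refine ⟨?_, ?_, fun L _ N hN => ⟨logTwo N, ?_, isLogTwo_logTwo N, ?_, fun h => ?_⟩,
    fun f hf => ?_⟩
  · exact exists_iso_log_pow countable_archTheory countable_Icc01
      (fun _ => isModel_archTheory_iff) fun _ => isModel_Icc01_iff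
  · exact exists_iso_log_pow countable_archPosTheory countable_Ioc01
      (fun _ => isModel_archPosTheory_iff) fun _ => isModel_Ioc01_iff
  · exact isModel_logTwo hN countable_archTheory (fun _ => isModel_archTheory_iff.1)
      fun _ => isModel_Icc01_iff.2
  · have := isAbsPow_powOf (logTwo N)
    rwa [powOf_logTwo hN countable_archTheory fun _ => isModel_archTheory_iff.1] at this
  · exact isModel_logTwo h countable_archPosTheory (fun _ => isModel_archPosTheory_iff.1)
      fun _ => isModel_Ioc01_iff.2
  · obtain ⟨α, hα, h⟩ := exists_eq_absPow_of_one_le f hf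
    refine ⟨α, hα.1, hα.2, ?_, fun x hx => (h x).trans (absPow_of_ne α hx), ?_⟩
    · rw [h, absPow_two, Real.logb_rpow two_pos (by norm_num)]
    · rintro ⟨n, hn, hn'⟩
      -- Exponent `0` would give `f n = 1`, contradicting `1 < f n`.
      refine hα.1.lt_of_ne fun h0 => hn'.ne' ?_
      rw [h, ← h0, absPow_of_ne 0 (by exact_mod_cast hn), Real.rpow_zero]
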